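/- Theorem 8 (posterior in the deterministic limit). Let $\mathcal X\subseteq\mathbb R^D$ and $\mathcal Y\subseteq\mathbb R^d$ be open sets (coordinate domains), let $M$ be a smooth Riemannian metric on $\mathcal X$, given by positive definite symmetric matrices $M(x)$, and let $f:\mathcal Y\to\mathcal X$ be a smooth embedding (smooth, a homeomorphism onto its image, with Jacobian $J_f(y)$ of full column rank for every $y\in\mathcal Y$). Let $J_f^\top MJ_f$ denote the pull-back metric $y\mapsto J_f(y)^\top M(f(y))J_f(y)$ on $\mathcal Y$. For an open set $U\subseteq\mathbb R^n$ with a metric $g$, a point $\mu\in U$ and $\lambda>0$, let the Gaussian on $(U,g)$ be the density $$G_{U,g}(x\mid\mu,\lambda I)=\frac1Z\exp\Big(-\frac\lambda2(x-\mu)^\top g(\mu)(x-\mu)\Big),\qquad Z=\int_U\exp\Big(-\frac\lambda2(x-\mu)^\top g(\mu)(x-\mu)\Big)\,dx .$$ Assume that the geometry is uniform along $f(\mathcal Y)$: there are constants $0<c\le C$ with $c|v|^2\le v^\top M(f(y))v\le C|v|^2$ for all $y\in\mathcal Y$, $v\in\mathbb R^D$, and for every $r>0$ the Lebesgue volume of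 $\mathcal X\cap B(f(y),r)$ is bounded below by a positive constant independent of $y\in\mathcal Y$. (All this holds automatically if $f(\mathcal Y)$ is contained in a compact subset of $\mathcal X$; the volume condition also holds if $\mathcal X=\mathbb R^D$.) Let $p$ be a smooth probability density on $\mathcal Y$ (the prior), and let $p_\lambda(x\mid y)=G_{\mathcal X,M}(x\mid f(y),\lambda I)$ be the likelihood. Let $x\in f(\mathcal Y)$ with $p(f^{-1}(x))>0$. Then for every $\lambda>0$ the evidence $p_\lambda(x)=\int_{\mathcal Y}p(y)\,p_\lambda(x\mid y)\,dy$ is positive and finite, so that the Bayesian posterior density $p_\lambda(y\mid x)=p(y)\,p_\lambda(x\mid y)/p_\lambda(x)$ is well defined; and as $\lambda\to\infty$ it is asymptotically the Gaussian $G_\lambda(y)=G_{\mathcal Y,\,J_f^\top MJ_f}(y\mid f^{-1}(x),\lambda I)$, which is centred at $f^{-1}(x)$ and has precision matrix $\lambda J_f^\top M(x)J_f$ with $J_f=J_f(f^{-1}(x))$, in the following two senses: 1. $\displaystyle\lim_{\lambda\to\infty}\int_{\mathcal Y}\big|p_\lambda(y\mid x)-G_\lambda(y)\big|\,dy=0$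 (convergence in total variation); 2. for every $R>0$, $\displaystyle\lim_{\lambda\to\infty}\ \sup\Big\{\Big|\frac{p_\lambda(y\mid x)}{G_\lambda(y)}-1\Big| : y\in\mathcal Y,\ |y-f^{-1}(x)|\le R/\sqrt\lambda\Big\}=0$. -/

import Mathlib

open MeasureTheory Filter Topology
open scoped ContDiff Matrix

noncomputable section

namespace RiemGauss

/-- The squared length `vᵀ A v`. -/
def metricSq {n : ℕ} (A : Matrix (Fin n) (Fin n) ℝ) (v : EuclideanSpace ℝ (Fin n)) : ℝ :=
  v.ofLp ⬝ᵥ (A *ᵥ v.ofLp)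

/-- `M` is a smooth Riemannian metric on `X`, an open coordinate domain of `ℝⁿ`. -/
structure IsMetricOn {n : ℕ} (M : EuclideanSpace ℝ (Fin n) → Matrix (Fin n) (Fin n) ℝ)
    (X : Set (EuclideanSpace ℝ (Fin n))) : Prop where
  smooth : ∀ i j, ContDiffOn ℝ ∞ (fun x => M x i j) X
  posDef : ∀ x ∈ X, (M x).PosDef

/-- The Jacobian matrix `∂fᵢ/∂yⱼ` at `y`. -/
def jacobian {d D : ℕ} (f : EuclideanSpace ℝ (Fin d) → EuclideanSpace ℝ (Fin D))
    (y : EuclideanSpace ℝ (Fin d)) : Matrix (Fin D) (Fin d) ℝ :=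
  Matrix.of fun i j => fderiv ℝ f y (EuclideanSpace.single j 1) i

/-- `f` is a smooth embedding of `Y` into `X`: a smooth map, of full column rank everywhere,
which is a homeomorphism onto its image. -/
structure IsSmoothEmbeddingOn {d D : ℕ}
    (f : EuclideanSpace ℝ (Fin d) → EuclideanSpace ℝ (Fin D))
    (Y : Set (EuclideanSpace ℝ (Fin d))) (X : Set (EuclideanSpace ℝ (Fin D))) : Prop where
  mapsTo : Set.MapsTo f Y X
  smooth : ContDiffOn ℝ ∞ f Y
  fullRank : ∀ y ∈ Y, (jacobian f y).rank = d
  isEmbedding : IsEmbedding (Y.domRestrict f)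

/-- The pull-back metric `y ↦ J(y)ᵀ M(f(y)) J(y)`. -/
def pullbackMetric {d D : ℕ} (f : EuclideanSpace ℝ (Fin d) → EuclideanSpace ℝ (Fin D))
    (M : EuclideanSpace ℝ (Fin D) → Matrix (Fin D) (Fin D) ℝ)
    (y : EuclideanSpace ℝ (Fin d)) : Matrix (Fin d) (Fin d) ℝ :=
  (jacobian f y)ᵀ * M (f y) * jacobian f y

/-- `exp(-(lam/2) (x-μ)ᵀ M(μ) (x-μ))`. -/
def gaussKernel {n : ℕ} (M : EuclideanSpace ℝ (Fin n) → Matrix (Fin n) (Fin n) ℝ)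
    (lam : ℝ) (μ x : EuclideanSpace ℝ (Fin n)) : ℝ :=
  Real.exp (-(lam / 2) * metricSq (M μ) (x - μ))

/-- The normalizing constant `Z = ∫_X exp(-(lam/2) (x-μ)ᵀ M(μ) (x-μ)) dx`. -/
def gaussZ {n : ℕ} (X : Set (EuclideanSpace ℝ (Fin n)))
    (M : EuclideanSpace ℝ (Fin n) → Matrix (Fin n) (Fin n) ℝ)
    (lam : ℝ) (μ : EuclideanSpace ℝ (Fin n)) : ℝ :=
  ∫ x in X, gaussKernel M lam μ x

/-- The density at `x` of the Gaussian `G(· | μ, lam I)` on `X` with respect to the metric `M`. -/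
def gaussDensity {n : ℕ} (X : Set (EuclideanSpace ℝ (Fin n)))
    (M : EuclideanSpace ℝ (Fin n) → Matrix (Fin n) (Fin n) ℝ)
    (lam : ℝ) (μ x : EuclideanSpace ℝ (Fin n)) : ℝ :=
  gaussKernel M lam μ x / gaussZ X M lam μ

/-- The joint density `p(x, y) = p(y) p(x | y)` with `p(x | y) = G(x | f(y), lam I)`. -/
def jointDensity {d D : ℕ} (X : Set (EuclideanSpace ℝ (Fin D)))
    (M : EuclideanSpace ℝ (Fin D) → Matrix (Fin D) (Fin D) ℝ)
    (f : EuclideanSpace ℝ (Fin d) → EuclideanSpace ℝ (Fin D))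
    (p : EuclideanSpace ℝ (Fin d) → ℝ) (lam : ℝ)
    (x : EuclideanSpace ℝ (Fin D)) (y : EuclideanSpace ℝ (Fin d)) : ℝ :=
  p y * gaussDensity X M lam (f y) x

/-- The evidence `p(x) = ∫_Y p(x, y) dy`. -/
def evidence {d D : ℕ} (X : Set (EuclideanSpace ℝ (Fin D)))
    (M : EuclideanSpace ℝ (Fin D) → Matrix (Fin D) (Fin D) ℝ)
    (Y : Set (EuclideanSpace ℝ (Fin d)))
    (f : EuclideanSpace ℝ (Fin d) → EuclideanSpace ℝ (Fin D))
    (p : EuclideanSpace ℝ (Fin d) → ℝ) (lam : ℝ) (x : EuclideanSpace ℝ (Fin D)) : ℝ :=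
  ∫ y in Y, jointDensity X M f p lam x y

/-- The posterior density `p(y | x) = p(x, y) / p(x)` (Bayes' rule). -/
def posteriorDensity {d D : ℕ} (X : Set (EuclideanSpace ℝ (Fin D)))
    (M : EuclideanSpace ℝ (Fin D) → Matrix (Fin D) (Fin D) ℝ)
    (Y : Set (EuclideanSpace ℝ (Fin d)))
    (f : EuclideanSpace ℝ (Fin d) → EuclideanSpace ℝ (Fin D))
    (p : EuclideanSpace ℝ (Fin d) → ℝ) (lam : ℝ)
    (x : EuclideanSpace ℝ (Fin D)) (y : EuclideanSpace ℝ (Fin d)) : ℝ :=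
  jointDensity X M f p lam x y / evidence X M Y f p lam x

/-- Uniformity of the geometry of `(X, M)` along the image `f(Y)`: the metric is uniformly
comparable there with the Euclidean one, and `X` does not get arbitrarily thin. Both hold
if `f(Y)` lies in a compact subset of `X`; the second one also if `X` is all of `ℝᴰ`. -/
structure UniformAlong {d D : ℕ} (X : Set (EuclideanSpace ℝ (Fin D)))
    (M : EuclideanSpace ℝ (Fin D) → Matrix (Fin D) (Fin D) ℝ)
    (Y : Set (EuclideanSpace ℝ (Fin d)))
    (f : EuclideanSpace ℝ (Fin d) → EuclideanSpace ℝ (Fin D)) : Prop where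
  lower : ∃ c : ℝ, 0 < c ∧ ∀ y ∈ Y, ∀ v, c * ‖v‖ ^ 2 ≤ metricSq (M (f y)) v
  upper : ∃ C : ℝ, ∀ y ∈ Y, ∀ v, metricSq (M (f y)) v ≤ C * ‖v‖ ^ 2
  thick : ∀ r : ℝ, 0 < r → ∃ m : ENNReal, 0 < m ∧
    ∀ y ∈ Y, m ≤ volume (X ∩ Metric.ball (f y) r)

end RiemGauss

end

/-! At distance `lam ^ (-1/2)` from `y₀` the exponent of the likelihood becomes the quadratic form
of the pull-back metric, and the normalizing constant times `√lam ^ D` tends to the full Gaussian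
integral for `M (f y₀)`; hence the joint density divided by the Gaussian kernel of the pull-back
metric tends, after rescaling, to a constant. The evidence has the matching asymptotics: near `y₀`
by dominated convergence, while the part away from `y₀` decays exponentially, because `f` is an
embedding and the uniform thickness of `X` keeps the normalizing constants above a multiple of
`exp (-σ * lam)` for every `σ > 0`. So the density ratio tends to one at scale `lam ^ (-1/2)`, and
since both densities integrate to one, this gives convergence in total variation (Scheffé). -/

namespace RiemGauss

section Integration

variable {E G ι : Type*} [NormedAddCommGroup E] [NormedSpace ℝ E] [FiniteDimensional ℝ E]
  [MeasurableSpace E] [BorelSpace E] {μ : Measure E} [μ.IsAddHaarMeasure]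
  [NormedAddCommGroup G] [NormedSpace ℝ G]

theorem integral_comp_add_inv_smul (F : E → G) (m : E) {s : ℝ} (hs : 0 ≤ s) :
    ∫ u, F (m + s⁻¹ • u) ∂μ = s ^ Module.finrank ℝ E • ∫ x, F x ∂μ := by
  rw [Measure.integral_comp_inv_smul_of_nonneg μ (fun w => F (m + w)) hs,
    integral_add_left_eq_self F m]

theorem tendsto_pow_finrank_smul_setIntegral {l : Filter ι} [l.IsCountablyGenerated]
    {X : Set E} {m₀ : E} {s : ι → ℝ} {m : ι → E} {F : ι → E → G} {β : E → G} {bound : E → ℝ}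
    (hX : MeasurableSet X) (hX_nhds : X ∈ 𝓝 m₀) (hs : Tendsto s l atTop)
    (hm : Tendsto m l (𝓝 m₀)) (hF_meas : ∀ᶠ i in l, AEStronglyMeasurable (F i) (μ.restrict X))
    (h_bound : ∀ᶠ i in l, ∀ x ∈ X, ‖F i x‖ ≤ bound (s i • (x - m i)))
    (h_int : Integrable bound μ)
    (h_lim : ∀ᵐ u ∂μ, Tendsto (fun i => F i (m i + (s i)⁻¹ • u)) l (𝓝 (β u))) :
    Tendsto (fun i => s i ^ Module.finrank ℝ E • ∫ x in X, F i x ∂μ) l (𝓝 (∫ u, β u ∂μ)) := by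
  have key : Tendsto (fun i => ∫ u, X.indicator (F i) (m i + (s i)⁻¹ • u) ∂μ) l
      (𝓝 (∫ u, β u ∂μ)) := by
    refine tendsto_integral_filter_of_dominated_convergence (fun u => ‖bound u‖) ?_ ?_
      h_int.norm ?_
    · filter_upwards [hs.eventually_gt_atTop 0, hF_meas, h_bound] with i hsi hFi hbi
      have hFX : IntegrableOn (F i) X μ :=
        (((h_int.comp_smul hsi.ne').comp_sub_right (m i)).integrableOn).mono' hFi
          (ae_restrict_of_forall_mem hX hbi)
      exact (((hFX.integrable_indicator hX).comp_add_left (m i)).comp_smul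
        (inv_ne_zero hsi.ne')).aestronglyMeasurable
    · filter_upwards [hs.eventually_gt_atTop 0, h_bound] with i hsi hbi
      refine Eventually.of_forall fun u => ?_
      by_cases hu : m i + (s i)⁻¹ • u ∈ X
      · have := hbi _ hu
        rw [add_sub_cancel_left, smul_inv_smul₀ hsi.ne'] at this
        rw [Set.indicator_of_mem hu]
        exact this.trans (le_abs_self _)
      · simp only [Set.indicator_of_notMem hu, norm_zero, norm_nonneg]
    · filter_upwards [h_lim] with u hu
      have h_point : Tendsto (fun i => m i + (s i)⁻¹ • u) l (𝓝 m₀) := by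
        simpa using hm.add (hs.inv_tendsto_atTop.smul_const u)
      refine hu.congr' ?_
      filter_upwards [h_point.eventually_mem hX_nhds] with i hi
      rw [Set.indicator_of_mem hi]
  refine key.congr' ?_
  filter_upwards [hs.eventually_ge_atTop 0] with i hsi
  rw [integral_comp_add_inv_smul _ _ hsi, integral_indicator hX]

theorem integral_abs_sub_eq_two_mul_integral_max {α : Type*} [MeasurableSpace α] {ν : Measure α}
    {q g : α → ℝ} (hq : Integrable q ν) (hg : Integrable g ν) (h : ∫ a, q a ∂ν = ∫ a, g a ∂ν) :
    ∫ a, |q a - g a| ∂ν = 2 * ∫ a, max (g a - q a) 0 ∂ν := by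
  have h_abs (a : α) : |q a - g a| = 2 * max (g a - q a) 0 - (g a - q a) := by
    rcases le_total (g a) (q a) with hle | hle
    · rw [abs_of_nonneg (sub_nonneg.2 hle), max_eq_right (sub_nonpos.2 hle)]; ring
    · rw [abs_of_nonpos (sub_nonpos.2 hle), max_eq_left (sub_nonneg.2 hle)]; ring
  have h_diff : Integrable (fun a => g a - q a) ν := hg.sub hq
  simp only [h_abs]
  rw [integral_sub (h_diff.pos_part.const_mul 2) h_diff, integral_const_mul,
    integral_sub hg hq, h, sub_self, sub_zero]

end Integration

theorem isLittleO_mul_sub_mul {α R 𝕜 : Type*} [SeminormedRing R] [NormedDivisionRing 𝕜]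
    {l : Filter α} {u u' v v' : α → R} {g h : α → 𝕜}
    (hu : (fun a => u a - u' a) =o[l] g) (hu' : u' =O[l] g)
    (hv : (fun a => v a - v' a) =o[l] h) (hv' : v' =O[l] h) :
    (fun a => u a * v a - u' a * v' a) =o[l] fun a => g a * h a := by
  have hv_big : v =O[l] h := by simpa using hv.isBigO.add hv'
  refine ((hu.mul_isBigO hv_big).add (hu'.mul_isLittleO hv)).congr_left fun a => ?_
  noncomm_ring

section QuadraticForm

variable {n : ℕ}

theorem metricSq_eq_sum (A : Matrix (Fin n) (Fin n) ℝ) (v : EuclideanSpace ℝ (Fin n)) :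
    metricSq A v = ∑ i, ∑ j, A i j * (v i * v j) := by
  simp only [metricSq, dotProduct, Matrix.mulVec, Finset.mul_sum]
  exact Finset.sum_congr rfl fun i _ => Finset.sum_congr rfl fun j _ => by ring

theorem metricSq_smul (A : Matrix (Fin n) (Fin n) ℝ) (t : ℝ) (v : EuclideanSpace ℝ (Fin n)) :
    metricSq A (t • v) = t ^ 2 * metricSq A v := by
  simp only [metricSq, WithLp.ofLp_smul, Matrix.mulVec_smul, smul_dotProduct, dotProduct_smul,
    smul_eq_mul]
  ring

theorem metricSq_neg (A : Matrix (Fin n) (Fin n) ℝ) (v : EuclideanSpace ℝ (Fin n)) :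
    metricSq A (-v) = metricSq A v := by
  simpa using metricSq_smul A (-1) v

theorem continuous_metricSq :
    Continuous fun q : Matrix (Fin n) (Fin n) ℝ × EuclideanSpace ℝ (Fin n) =>
      metricSq q.1 q.2 := by
  unfold metricSq
  fun_prop

theorem aestronglyMeasurable_metricSq {α : Type*} [MeasurableSpace α] {ν : Measure α}
    {A : α → Matrix (Fin n) (Fin n) ℝ} {v : α → EuclideanSpace ℝ (Fin n)}
    (hA : AEStronglyMeasurable A ν) (hv : AEStronglyMeasurable v ν) :
    AEStronglyMeasurable (fun a => metricSq (A a) (v a)) ν :=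
  continuous_metricSq.comp_aestronglyMeasurable (hA.prodMk hv)

theorem isLittleO_metricSq_sub {α : Type*} {l : Filter α}
    {A : α → Matrix (Fin n) (Fin n) ℝ} {A₀ : Matrix (Fin n) (Fin n) ℝ}
    {v w : α → EuclideanSpace ℝ (Fin n)} {g : α → ℝ} (hA : Tendsto A l (𝓝 A₀))
    (hvw : (fun a => v a - w a) =o[l] g) (hw : w =O[l] g) :
    (fun a => metricSq (A a) (v a) - metricSq A₀ (w a)) =o[l] fun a => g a ^ 2 := by
  have h_coord (u : α → EuclideanSpace ℝ (Fin n)) (i : Fin n) : (fun a => u a i) =O[l] u :=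
    Asymptotics.isBigO_of_le l fun a => PiLp.norm_apply_le (u a) i
  have h_entry (i j : Fin n) : (fun a => A a i j - A₀ i j) =o[l] fun _ => (1 : ℝ) := by
    rw [Asymptotics.isLittleO_one_iff, tendsto_sub_nhds_zero_iff]
    exact ((continuous_apply_apply i j).tendsto A₀).comp hA
  simp only [metricSq_eq_sum, ← Finset.sum_sub_distrib]
  refine .fun_sum fun i _ => ?_
  refine .fun_sum fun j _ => ?_
  have h_term (k : Fin n) : (fun a => v a k - w a k) =o[l] g :=
    (h_coord (fun a => v a - w a) k).trans_isLittleO hvw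
  have h_prod := isLittleO_mul_sub_mul (h_term i) ((h_coord w i).trans hw)
    (h_term j) ((h_coord w j).trans hw)
  simpa only [one_mul, ← sq] using isLittleO_mul_sub_mul (h_entry i j)
    (Asymptotics.isBigO_const_const (A₀ i j) one_ne_zero l) h_prod
    (((h_coord w i).trans hw).mul ((h_coord w j).trans hw))

end QuadraticForm

section Jacobian

variable {d D : ℕ} {f : EuclideanSpace ℝ (Fin d) → EuclideanSpace ℝ (Fin D)}
  {M : EuclideanSpace ℝ (Fin D) → Matrix (Fin D) (Fin D) ℝ} {y : EuclideanSpace ℝ (Fin d)}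

theorem jacobian_mulVec (v : EuclideanSpace ℝ (Fin d)) :
    jacobian f y *ᵥ v.ofLp = (fderiv ℝ f y v).ofLp := by
  have hv : v = ∑ j, v j • EuclideanSpace.single j (1 : ℝ) := by
    ext i
    simp [Finset.sum_apply, Pi.single_apply]
  ext i
  conv_rhs => rw [hv]
  simp [jacobian, Matrix.mulVec, dotProduct, mul_comm]

theorem metricSq_pullbackMetric (v : EuclideanSpace ℝ (Fin d)) :
    metricSq (pullbackMetric f M y) v = metricSq (M (f y)) (fderiv ℝ f y v) := by
  simp only [metricSq, pullbackMetric, ← jacobian_mulVec, ← Matrix.mulVec_mulVec,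
    Matrix.dotProduct_mulVec, Matrix.vecMul_transpose]

theorem fderiv_injective_of_rank (h : (jacobian f y).rank = d) :
    Function.Injective (fderiv ℝ f y) := by
  have hli : LinearIndependent ℝ (jacobian f y).col := by
    rw [linearIndependent_iff_card_eq_finrank_span, Set.finrank, ← Matrix.rank_eq_finrank_span_cols,
      h, Fintype.card_fin]
  intro v w hvw
  apply WithLp.ofLp_injective 2
  apply Matrix.mulVec_injective_iff.2 hli
  simp only [jacobian_mulVec, hvw]

theorem exists_mul_norm_sq_le_pullbackMetric (h_rank : (jacobian f y).rank = d) {c : ℝ}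
    (hc : 0 < c) (hM : ∀ v, c * ‖v‖ ^ 2 ≤ metricSq (M (f y)) v) :
    ∃ κ > 0, ∀ v, κ * ‖v‖ ^ 2 ≤ metricSq (pullbackMetric f M y) v := by
  obtain ⟨K, hK_pos, hK⟩ := (fderiv ℝ f y).toLinearMap.exists_antilipschitzWith
    (LinearMap.ker_eq_bot.2 (fderiv_injective_of_rank h_rank))
  refine ⟨c * (K : ℝ)⁻¹ ^ 2, by positivity, fun v => ?_⟩
  have hKv : (K : ℝ)⁻¹ * ‖v‖ ≤ ‖fderiv ℝ f y v‖ :=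
    (inv_mul_le_iff₀ (NNReal.coe_pos.2 hK_pos)).2 (hK.le_mul_norm (map_zero _) v)
  calc c * (K : ℝ)⁻¹ ^ 2 * ‖v‖ ^ 2 = c * ((K : ℝ)⁻¹ * ‖v‖) ^ 2 := by ring
    _ ≤ c * ‖fderiv ℝ f y v‖ ^ 2 := by gcongr
    _ ≤ metricSq (pullbackMetric f M y) v := (hM _).trans_eq (metricSq_pullbackMetric v).symm

theorem exists_eventually_mul_norm_sub_le (hf : DifferentiableAt ℝ f y)
    (h_rank : (jacobian f y).rank = d) :
    ∃ k > 0, ∀ᶠ z in 𝓝 y, k * ‖z - y‖ ≤ ‖f z - f y‖ := by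
  have h_inj : Topology.IsInducing (fderiv ℝ f y) :=
    ((fderiv ℝ f y).toLinearMap.isClosedEmbedding_of_injective
      (LinearMap.ker_eq_bot.2 (fderiv_injective_of_rank h_rank))).isInducing
  obtain ⟨K, hK_pos, hK⟩ := (hf.hasFDerivAt.isTheta_sub h_inj).2.exists_pos
  refine ⟨K⁻¹, by positivity, hK.bound.mono fun z hz => ?_⟩
  rwa [inv_mul_le_iff₀ hK_pos]

end Jacobian

section Gaussian

variable {n : ℕ} {X : Set (EuclideanSpace ℝ (Fin n))}
  {M : EuclideanSpace ℝ (Fin n) → Matrix (Fin n) (Fin n) ℝ} {A : Matrix (Fin n) (Fin n) ℝ}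
  {μ : EuclideanSpace ℝ (Fin n)} {c lam : ℝ}

/-- The mass of the unnormalized centred Gaussian on all of `ℝⁿ` with precision matrix `A`; it is
the limit of the normalizing constants `gaussZ` once lengths are measured in units of
`lam ^ (-1/2)`. -/
noncomputable def gaussMass (A : Matrix (Fin n) (Fin n) ℝ) : ℝ :=
  ∫ v, Real.exp (-(1 / 2) * metricSq A v)

theorem integrable_exp_neg_mul_norm_sq {V : Type*} [NormedAddCommGroup V] [InnerProductSpace ℝ V]
    [FiniteDimensional ℝ V] [MeasurableSpace V] [BorelSpace V] {b : ℝ} (hb : 0 < b) :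
    Integrable fun v : V => Real.exp (-b * ‖v‖ ^ 2) := by
  refine Integrable.of_integral_ne_zero ?_
  rw [GaussianFourier.integral_rexp_neg_mul_sq_norm hb]
  positivity

theorem integrable_exp_neg_metricSq (hc : 0 < c) (hA : ∀ v, c * ‖v‖ ^ 2 ≤ metricSq A v) :
    Integrable fun v => Real.exp (-(1 / 2) * metricSq A v) := by
  have h_cont : Continuous (metricSq A) := continuous_metricSq.comp (Continuous.prodMk_right A)
  refine (integrable_exp_neg_mul_norm_sq (half_pos hc)).mono' (by fun_prop)
    (Eventually.of_forall fun v => ?_)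
  rw [Real.norm_of_nonneg (Real.exp_nonneg _), Real.exp_le_exp]
  linarith [hA v]

theorem gaussMass_pos (hc : 0 < c) (hA : ∀ v, c * ‖v‖ ^ 2 ≤ metricSq A v) : 0 < gaussMass A :=
  integral_exp_pos (integrable_exp_neg_metricSq hc hA)

theorem gaussKernel_pos (M : EuclideanSpace ℝ (Fin n) → Matrix (Fin n) (Fin n) ℝ)
    (lam : ℝ) (μ x : EuclideanSpace ℝ (Fin n)) : 0 < gaussKernel M lam μ x :=
  Real.exp_pos _

theorem gaussKernel_eq_exp (M : EuclideanSpace ℝ (Fin n) → Matrix (Fin n) (Fin n) ℝ)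
    (μ x : EuclideanSpace ℝ (Fin n)) (hlam : 0 ≤ lam) :
    gaussKernel M lam μ x = Real.exp (-(1 / 2) * metricSq (M μ) (√lam • (x - μ))) := by
  rw [gaussKernel, metricSq_smul, Real.sq_sqrt hlam]
  congr 1
  ring

theorem gaussKernel_add_inv_smul (M : EuclideanSpace ℝ (Fin n) → Matrix (Fin n) (Fin n) ℝ)
    (μ u : EuclideanSpace ℝ (Fin n)) (hlam : 0 < lam) :
    gaussKernel M lam μ (μ + (√lam)⁻¹ • u) = Real.exp (-(1 / 2) * metricSq (M μ) u) := by
  rw [gaussKernel_eq_exp M _ _ hlam.le, add_sub_cancel_left,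
    smul_inv_smul₀ (Real.sqrt_pos.2 hlam).ne']

theorem gaussKernel_le_exp (hμ : ∀ v, c * ‖v‖ ^ 2 ≤ metricSq (M μ) v) (hlam : 0 ≤ lam)
    (x : EuclideanSpace ℝ (Fin n)) :
    gaussKernel M lam μ x ≤ Real.exp (-(c / 2) * ‖√lam • (x - μ)‖ ^ 2) := by
  rw [gaussKernel_eq_exp M _ _ hlam, Real.exp_le_exp]
  linarith [hμ (√lam • (x - μ))]

theorem integrable_gaussKernel (hc : 0 < c) (hμ : ∀ v, c * ‖v‖ ^ 2 ≤ metricSq (M μ) v)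
    (hlam : 0 < lam) : Integrable (gaussKernel M lam μ) := by
  simp only [funext fun x => gaussKernel_eq_exp M μ x hlam.le]
  exact ((integrable_exp_neg_metricSq hc hμ).comp_smul
    (Real.sqrt_pos.2 hlam).ne').comp_sub_right μ

theorem le_gaussZ (hX : MeasurableSet X) (h_int : IntegrableOn (gaussKernel M lam μ) X)
    (hlam : 0 ≤ lam) {r B : ℝ} (hB : ∀ v, ‖v‖ < r → metricSq (M μ) v ≤ B) :
    volume.real (X ∩ Metric.ball μ r) * Real.exp (-(lam / 2) * B) ≤ gaussZ X M lam μ := by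
  have h_meas : MeasurableSet (X ∩ Metric.ball μ r) := hX.inter measurableSet_ball
  have h_fin : volume (X ∩ Metric.ball μ r) ≠ ⊤ :=
    measure_ne_top_of_subset Set.inter_subset_right measure_ball_lt_top.ne
  calc volume.real (X ∩ Metric.ball μ r) * Real.exp (-(lam / 2) * B)
      = Real.exp (-(lam / 2) * B) * volume.real (X ∩ Metric.ball μ r) := mul_comm _ _
    _ ≤ ∫ z in X ∩ Metric.ball μ r, gaussKernel M lam μ z := by
        refine setIntegral_ge_of_const_le_real h_meas h_fin (fun z hz => ?_)
          (h_int.mono_set Set.inter_subset_left)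
        exact Real.exp_le_exp.2 (mul_le_mul_of_nonpos_left
          (hB _ (mem_ball_iff_norm.1 hz.2)) (by linarith))
    _ ≤ gaussZ X M lam μ :=
        setIntegral_mono_set h_int (Eventually.of_forall fun z => (gaussKernel_pos M lam μ z).le)
          Set.inter_subset_left.eventuallyLE

theorem tendsto_sqrt_pow_mul_gaussZ {ι : Type*} {l : Filter ι} [l.IsCountablyGenerated]
    {lam : ι → ℝ} {m : ι → EuclideanSpace ℝ (Fin n)} (hX : MeasurableSet X) (hX_nhds : X ∈ 𝓝 μ)
    (hlam : Tendsto lam l atTop) (hm : Tendsto m l (𝓝 μ))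
    (hM : Tendsto (fun i => M (m i)) l (𝓝 (M μ))) (hc : 0 < c)
    (h_low : ∀ᶠ i in l, ∀ v, c * ‖v‖ ^ 2 ≤ metricSq (M (m i)) v) :
    Tendsto (fun i => √(lam i) ^ n * gaussZ X M (lam i) (m i)) l (𝓝 (gaussMass (M μ))) := by
  have key := tendsto_pow_finrank_smul_setIntegral (μ := volume) (s := fun i => √(lam i))
    (F := fun i => gaussKernel M (lam i) (m i))
    (β := fun u => Real.exp (-(1 / 2) * metricSq (M μ) u))
    (bound := fun u => Real.exp (-(c / 2) * ‖u‖ ^ 2)) hX hX_nhds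
    (Real.tendsto_sqrt_atTop.comp hlam) hm ?_ ?_ (integrable_exp_neg_mul_norm_sq (half_pos hc)) ?_
  · simpa only [finrank_euclideanSpace_fin, smul_eq_mul, gaussZ, gaussMass] using key
  · filter_upwards [hlam.eventually_gt_atTop 0, h_low] with i hi h_low_i
    exact (integrable_gaussKernel hc h_low_i hi).aestronglyMeasurable.restrict
  · filter_upwards [hlam.eventually_gt_atTop 0, h_low] with i hi h_low_i x _
    rw [Real.norm_of_nonneg (gaussKernel_pos _ _ _ _).le]
    exact gaussKernel_le_exp h_low_i hi.le x
  · refine Eventually.of_forall fun u => ?_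
    have h_quad : Tendsto (fun i => metricSq (M (m i)) u) l (𝓝 (metricSq (M μ) u)) :=
      (continuous_metricSq.tendsto (M μ, u)).comp (hM.prodMk_nhds tendsto_const_nhds)
    refine ((Real.continuous_exp.tendsto _).comp (h_quad.const_mul (-(1 / 2)))).congr' ?_
    filter_upwards [hlam.eventually_gt_atTop 0] with i hi
    exact (gaussKernel_add_inv_smul M (m i) u hi).symm

end Gaussian

section Likelihood

variable {d D : ℕ} {X : Set (EuclideanSpace ℝ (Fin D))}
  {M : EuclideanSpace ℝ (Fin D) → Matrix (Fin D) (Fin D) ℝ} {Y : Set (EuclideanSpace ℝ (Fin d))}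
  {f : EuclideanSpace ℝ (Fin d) → EuclideanSpace ℝ (Fin D)} {y₀ : EuclideanSpace ℝ (Fin d)}

theorem tendsto_nhds_of_sub_isBigO_inv_sqrt {E ι : Type*} [NormedAddCommGroup E] {l : Filter ι}
    {lam : ι → ℝ} {y : ι → E} {a : E} (hlam : Tendsto lam l atTop)
    (hy : (fun i => y i - a) =O[l] fun i => (√(lam i))⁻¹) : Tendsto y l (𝓝 a) :=
  tendsto_sub_nhds_zero_iff.1
    (hy.trans_tendsto (Real.tendsto_sqrt_atTop.comp hlam).inv_tendsto_atTop)

theorem isBigO_add_inv_sqrt_smul_sub {E : Type*} [NormedAddCommGroup E] [NormedSpace ℝ E] (a u : E)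
    (l : Filter ℝ) : (fun lam => a + (√lam)⁻¹ • u - a) =O[l] fun lam => (√lam)⁻¹ := by
  simp only [add_sub_cancel_left]
  refine Asymptotics.IsBigO.of_bound ‖u‖ (Eventually.of_forall fun lam => ?_)
  rw [norm_smul, mul_comm]

theorem tendsto_gaussKernel_div_gaussKernel_pullbackMetric {ι : Type*} {l : Filter ι}
    {lam : ι → ℝ} {y : ι → EuclideanSpace ℝ (Fin d)} (hf : DifferentiableAt ℝ f y₀)
    (hM : ContinuousAt (fun y => M (f y)) y₀) (hlam : Tendsto lam l atTop)
    (hy : (fun i => y i - y₀) =O[l] fun i => (√(lam i))⁻¹) :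
    Tendsto (fun i => gaussKernel M (lam i) (f (y i)) (f y₀) /
      gaussKernel (pullbackMetric f M) (lam i) y₀ (y i)) l (𝓝 1) := by
  have hy_lim := tendsto_nhds_of_sub_isBigO_inv_sqrt hlam hy
  have h_lin : (fun i => (f y₀ - f (y i)) - -fderiv ℝ f y₀ (y i - y₀)) =o[l]
      fun i => (√(lam i))⁻¹ :=
    ((hf.hasFDerivAt.isLittleO.comp_tendsto hy_lim).trans_isBigO hy).neg_left.congr_left
      fun i => by simp only [Function.comp_apply]; abel
  have h_quad := isLittleO_metricSq_sub (hM.tendsto.comp hy_lim) h_lin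
    (((fderiv ℝ f y₀).isBigO_comp _ l).trans hy).neg_left
  have h_scaled := (h_quad.tendsto_div_nhds_zero.const_mul (-(1 / 2))).rexp
  rw [mul_zero, Real.exp_zero] at h_scaled
  refine h_scaled.congr' ?_
  filter_upwards [hlam.eventually_ge_atTop 0] with i hi
  rw [gaussKernel, gaussKernel, ← Real.exp_sub, inv_pow, Real.sq_sqrt hi, div_inv_eq_mul,
    metricSq_neg, metricSq_pullbackMetric, Function.comp_apply]
  congr 1
  ring

theorem UniformAlong.exists_le_gaussZ (h : UniformAlong X M Y f) (hX : MeasurableSet X) {τ : ℝ}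
    (hτ : 0 < τ) :
    ∃ m > 0, ∀ lam > 0, ∀ y ∈ Y, m * Real.exp (-(lam * τ)) ≤ gaussZ X M lam (f y) := by
  obtain ⟨c, hc, h_low⟩ := h.lower
  obtain ⟨C, h_up⟩ := h.upper
  set C₁ := max C 1
  have hC₁ : 0 < C₁ := lt_max_of_lt_right one_pos
  set r := √(2 * τ / C₁)
  obtain ⟨m, hm, h_vol⟩ := h.thick r (by positivity)
  have h_min_ne_top : min m 1 ≠ ⊤ := (min_lt_of_right_lt ENNReal.one_lt_top).ne
  refine ⟨(min m 1).toReal, ENNReal.toReal_pos (lt_min hm one_pos).ne' h_min_ne_top,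
    fun lam hlam y hy => ?_⟩
  have h_fin : volume (X ∩ Metric.ball (f y) r) ≠ ⊤ :=
    measure_ne_top_of_subset Set.inter_subset_right measure_ball_lt_top.ne
  have h_ball (v : EuclideanSpace ℝ (Fin D)) (hv : ‖v‖ < r) : metricSq (M (f y)) v ≤ 2 * τ :=
    calc metricSq (M (f y)) v ≤ C * ‖v‖ ^ 2 := h_up y hy v
      _ ≤ C₁ * r ^ 2 := by gcongr; exact le_max_left C 1
      _ = 2 * τ := by rw [Real.sq_sqrt (by positivity)]; field_simp
  calc (min m 1).toReal * Real.exp (-(lam * τ))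
      ≤ volume.real (X ∩ Metric.ball (f y) r) * Real.exp (-(lam / 2) * (2 * τ)) := by
        rw [show -(lam / 2) * (2 * τ) = -(lam * τ) by ring]
        gcongr
        exact ENNReal.toReal_mono h_fin ((min_le_left m 1).trans (h_vol y hy))
    _ ≤ gaussZ X M lam (f y) :=
        le_gaussZ hX (integrable_gaussKernel hc (h_low y hy) hlam).integrableOn hlam.le h_ball

theorem UniformAlong.gaussZ_pos (h : UniformAlong X M Y f) (hX : MeasurableSet X) {lam : ℝ}
    (hlam : 0 < lam) {y : EuclideanSpace ℝ (Fin d)} (hy : y ∈ Y) : 0 < gaussZ X M lam (f y) := by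
  obtain ⟨m, hm, hZ⟩ := h.exists_le_gaussZ hX one_pos
  exact lt_of_lt_of_le (by positivity) (hZ lam hlam y hy)

theorem UniformAlong.gaussDensity_pos (h : UniformAlong X M Y f) (hX : MeasurableSet X) {lam : ℝ}
    (hlam : 0 < lam) {y : EuclideanSpace ℝ (Fin d)} (hy : y ∈ Y)
    (x : EuclideanSpace ℝ (Fin D)) : 0 < gaussDensity X M lam (f y) x :=
  div_pos (gaussKernel_pos M lam (f y) x) (h.gaussZ_pos hX hlam hy)

theorem UniformAlong.exists_gaussDensity_le (h : UniformAlong X M Y f) (hX : MeasurableSet X) :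
    ∃ c > 0, ∀ σ > 0, ∃ K ≥ 0, ∀ lam > 0, ∀ y ∈ Y, ∀ x,
      gaussDensity X M lam (f y) x ≤ K * Real.exp (lam * (σ - c * ‖x - f y‖ ^ 2)) := by
  obtain ⟨c, hc, h_low⟩ := h.lower
  refine ⟨c / 2, by positivity, fun σ hσ => ?_⟩
  obtain ⟨m, hm, hZ⟩ := h.exists_le_gaussZ hX hσ
  refine ⟨m⁻¹, by positivity, fun lam hlam y hy x => ?_⟩
  have h_kernel : gaussKernel M lam (f y) x ≤ Real.exp (-(lam * (c / 2 * ‖x - f y‖ ^ 2))) := by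
    refine Real.exp_le_exp.2 ?_
    have := mul_le_mul_of_nonneg_left (h_low y hy (x - f y)) (half_pos hlam).le
    linarith
  calc gaussDensity X M lam (f y) x
      ≤ Real.exp (-(lam * (c / 2 * ‖x - f y‖ ^ 2))) / (m * Real.exp (-(lam * σ))) := by
        rw [gaussDensity]
        gcongr
        exact hZ lam hlam y hy
    _ = m⁻¹ * Real.exp (lam * (σ - c / 2 * ‖x - f y‖ ^ 2)) := by
        rw [mul_comm m, ← div_div, ← Real.exp_sub, div_eq_inv_mul]
        congr 2
        ring

end Likelihood

/-- The local and uniform hypotheses behind the Laplace asymptotics at the latent point `y₀`: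
first-order regularity of `f` and of the metric at `y₀` alone, `f` of full rank there, and
`f y` close to `f y₀` only for `y` close to `y₀` (`separated`). The measurability fields make the
evidence meaningful. -/
structure IsRegularAt {d D : ℕ} (X : Set (EuclideanSpace ℝ (Fin D)))
    (M : EuclideanSpace ℝ (Fin D) → Matrix (Fin D) (Fin D) ℝ) (Y : Set (EuclideanSpace ℝ (Fin d)))
    (f : EuclideanSpace ℝ (Fin d) → EuclideanSpace ℝ (Fin D))
    (y₀ : EuclideanSpace ℝ (Fin d)) : Prop where
  measurableSet_domain : MeasurableSet Y
  measurableSet_codomain : MeasurableSet X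
  domain_mem_nhds : Y ∈ 𝓝 y₀
  codomain_mem_nhds : X ∈ 𝓝 (f y₀)
  aestronglyMeasurable_map : AEStronglyMeasurable f (volume.restrict Y)
  aestronglyMeasurable_metric : AEStronglyMeasurable (fun y => M (f y)) (volume.restrict Y)
  differentiableAt : DifferentiableAt ℝ f y₀
  continuousAt_metric : ContinuousAt (fun y => M (f y)) y₀
  rank_jacobian : (jacobian f y₀).rank = d
  separated : ∀ δ > 0, ∃ η > 0, ∀ y ∈ Y, δ ≤ ‖y - y₀‖ → η ≤ ‖f y₀ - f y‖
  uniformAlong : UniformAlong X M Y f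

theorem IsSmoothEmbeddingOn.exists_le_norm_sub {d D : ℕ}
    {X : Set (EuclideanSpace ℝ (Fin D))} {Y : Set (EuclideanSpace ℝ (Fin d))}
    {f : EuclideanSpace ℝ (Fin d) → EuclideanSpace ℝ (Fin D)} {y₀ : EuclideanSpace ℝ (Fin d)}
    (hf : IsSmoothEmbeddingOn f Y X) (hy₀ : y₀ ∈ Y) {δ : ℝ} (hδ : 0 < δ) :
    ∃ η > 0, ∀ y ∈ Y, δ ≤ ‖y - y₀‖ → η ≤ ‖f y₀ - f y‖ := by
  have h_nhds := Metric.ball_mem_nhds (⟨y₀, hy₀⟩ : Y) hδ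
  rw [hf.isEmbedding.nhds_eq_comap, (Metric.nhds_basis_ball.comap _).mem_iff] at h_nhds
  obtain ⟨η, hη, h_sub⟩ := h_nhds
  refine ⟨η, hη, fun y hy hyδ => ?_⟩
  contrapose! hyδ
  have : (⟨y, hy⟩ : Y) ∈ Metric.ball (⟨y₀, hy₀⟩ : Y) δ :=
    h_sub (mem_ball_iff_norm'.2 hyδ)
  exact mem_ball_iff_norm.1 this

theorem IsSmoothEmbeddingOn.isRegularAt {d D : ℕ} {X : Set (EuclideanSpace ℝ (Fin D))}
    {M : EuclideanSpace ℝ (Fin D) → Matrix (Fin D) (Fin D) ℝ} {Y : Set (EuclideanSpace ℝ (Fin d))}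
    {f : EuclideanSpace ℝ (Fin d) → EuclideanSpace ℝ (Fin D)} {y₀ : EuclideanSpace ℝ (Fin d)}
    (hf : IsSmoothEmbeddingOn f Y X) (hM : IsMetricOn M X) (h_unif : UniformAlong X M Y f)
    (hX : IsOpen X) (hY : IsOpen Y) (hy₀ : y₀ ∈ Y) : IsRegularAt X M Y f y₀ := by
  have : TopologicalSpace.PseudoMetrizableSpace (Matrix (Fin D) (Fin D) ℝ) :=
    inferInstanceAs (TopologicalSpace.PseudoMetrizableSpace (Fin D → Fin D → ℝ))
  have hM_cont : ContinuousOn M X :=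
    continuousOn_pi.2 fun i => continuousOn_pi.2 fun j => (hM.smooth i j).continuousOn
  have hMf_cont : ContinuousOn (fun y => M (f y)) Y :=
    hM_cont.comp hf.smooth.continuousOn hf.mapsTo
  have hY_nhds := hY.mem_nhds hy₀
  exact
    { measurableSet_domain := hY.measurableSet
      measurableSet_codomain := hX.measurableSet
      domain_mem_nhds := hY_nhds
      codomain_mem_nhds := hX.mem_nhds (hf.mapsTo hy₀)
      aestronglyMeasurable_map := hf.smooth.continuousOn.aestronglyMeasurable hY.measurableSet
      aestronglyMeasurable_metric := hMf_cont.aestronglyMeasurable hY.measurableSet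
      differentiableAt := (hf.smooth.contDiffAt hY_nhds).differentiableAt (by simp)
      continuousAt_metric := hMf_cont.continuousAt hY_nhds
      rank_jacobian := hf.fullRank y₀ hy₀
      separated := fun _ hδ => hf.exists_le_norm_sub hy₀ hδ
      uniformAlong := h_unif }

namespace IsRegularAt

variable {d D : ℕ} {X : Set (EuclideanSpace ℝ (Fin D))}
  {M : EuclideanSpace ℝ (Fin D) → Matrix (Fin D) (Fin D) ℝ} {Y : Set (EuclideanSpace ℝ (Fin d))}
  {f : EuclideanSpace ℝ (Fin d) → EuclideanSpace ℝ (Fin D)} {p : EuclideanSpace ℝ (Fin d) → ℝ}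
  {y₀ : EuclideanSpace ℝ (Fin d)}

theorem mem_domain (h : IsRegularAt X M Y f y₀) : y₀ ∈ Y := mem_of_mem_nhds h.domain_mem_nhds

theorem gaussMass_metric_pos (h : IsRegularAt X M Y f y₀) : 0 < gaussMass (M (f y₀)) := by
  obtain ⟨c, hc, h_low⟩ := h.uniformAlong.lower
  exact gaussMass_pos hc (h_low y₀ h.mem_domain)

theorem exists_mul_norm_sq_le_pullbackMetric (h : IsRegularAt X M Y f y₀) :
    ∃ κ > 0, ∀ v, κ * ‖v‖ ^ 2 ≤ metricSq (pullbackMetric f M y₀) v := by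
  obtain ⟨c, hc, h_low⟩ := h.uniformAlong.lower
  exact RiemGauss.exists_mul_norm_sq_le_pullbackMetric h.rank_jacobian hc (h_low y₀ h.mem_domain)

theorem gaussMass_pullbackMetric_pos (h : IsRegularAt X M Y f y₀) :
    0 < gaussMass (pullbackMetric f M y₀) := by
  obtain ⟨κ, hκ, h_pull⟩ := h.exists_mul_norm_sq_le_pullbackMetric
  exact gaussMass_pos hκ h_pull

section Asymptotics

variable {ι : Type*} {l : Filter ι} {lam : ι → ℝ} {y : ι → EuclideanSpace ℝ (Fin d)}

theorem tendsto_sqrt_pow_mul_gaussZ [l.IsCountablyGenerated] (h : IsRegularAt X M Y f y₀)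
    (hlam : Tendsto lam l atTop) (hy : Tendsto y l (𝓝 y₀)) :
    Tendsto (fun i => √(lam i) ^ D * gaussZ X M (lam i) (f (y i))) l
      (𝓝 (gaussMass (M (f y₀)))) := by
  obtain ⟨c, hc, h_low⟩ := h.uniformAlong.lower
  exact RiemGauss.tendsto_sqrt_pow_mul_gaussZ h.measurableSet_codomain h.codomain_mem_nhds hlam
    (h.differentiableAt.continuousAt.tendsto.comp hy) (h.continuousAt_metric.tendsto.comp hy) hc
    ((hy.eventually_mem h.domain_mem_nhds).mono fun i hi => h_low (y i) hi)

theorem tendsto_sqrt_pow_mul_gaussZ_pullbackMetric [l.IsCountablyGenerated]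
    (h : IsRegularAt X M Y f y₀) (hlam : Tendsto lam l atTop) :
    Tendsto (fun i => √(lam i) ^ d * gaussZ Y (pullbackMetric f M) (lam i) y₀) l
      (𝓝 (gaussMass (pullbackMetric f M y₀))) := by
  obtain ⟨κ, hκ, h_pull⟩ := h.exists_mul_norm_sq_le_pullbackMetric
  exact RiemGauss.tendsto_sqrt_pow_mul_gaussZ h.measurableSet_domain h.domain_mem_nhds hlam
    tendsto_const_nhds tendsto_const_nhds hκ (Eventually.of_forall fun _ => h_pull)

theorem tendsto_jointDensity_div_gaussKernel [l.IsCountablyGenerated]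
    (h : IsRegularAt X M Y f y₀) (hp : ContinuousAt p y₀) (hlam : Tendsto lam l atTop)
    (hy : (fun i => y i - y₀) =O[l] fun i => (√(lam i))⁻¹) :
    Tendsto (fun i => (√(lam i) ^ D)⁻¹ * jointDensity X M f p (lam i) (f y₀) (y i) /
      gaussKernel (pullbackMetric f M) (lam i) y₀ (y i)) l
      (𝓝 (p y₀ / gaussMass (M (f y₀)))) := by
  have hy_lim := tendsto_nhds_of_sub_isBigO_inv_sqrt hlam hy
  have h_lim := ((hp.tendsto.comp hy_lim).div (h.tendsto_sqrt_pow_mul_gaussZ hlam hy_lim)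
    h.gaussMass_metric_pos.ne').mul (tendsto_gaussKernel_div_gaussKernel_pullbackMetric
      h.differentiableAt h.continuousAt_metric hlam hy)
  rw [mul_one] at h_lim
  refine h_lim.congr fun i => ?_
  simp only [Pi.div_apply, Function.comp_apply, jointDensity, gaussDensity, div_eq_mul_inv, mul_inv]
  ring

end Asymptotics

theorem aestronglyMeasurable_jointDensity (h : IsRegularAt X M Y f y₀)
    (hp : AEStronglyMeasurable p (volume.restrict Y)) (lam : ℝ) (x : EuclideanSpace ℝ (Fin D)) :
    AEStronglyMeasurable (jointDensity X M f p lam x) (volume.restrict Y) := by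
  have h_kernel : AEStronglyMeasurable
      (fun q : EuclideanSpace ℝ (Fin d) × EuclideanSpace ℝ (Fin D) =>
        gaussKernel M lam (f q.1) q.2) ((volume.restrict Y).prod (volume.restrict X)) :=
    Real.continuous_exp.comp_aestronglyMeasurable <|
      (aestronglyMeasurable_metricSq h.aestronglyMeasurable_metric.comp_fst
        (measurable_snd.aestronglyMeasurable.sub h.aestronglyMeasurable_map.comp_fst)).const_mul _
  have h_kernel_x : AEStronglyMeasurable (fun y => gaussKernel M lam (f y) x)
      (volume.restrict Y) :=
    Real.continuous_exp.comp_aestronglyMeasurable <|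
      (aestronglyMeasurable_metricSq h.aestronglyMeasurable_metric
        (aestronglyMeasurable_const.sub h.aestronglyMeasurable_map)).const_mul _
  exact hp.mul (h_kernel_x.div₀ h_kernel.integral_prod_right')

theorem jointDensity_nonneg (h : IsRegularAt X M Y f y₀) (hp : ∀ y ∈ Y, 0 ≤ p y) {lam : ℝ}
    (hlam : 0 < lam) (x : EuclideanSpace ℝ (Fin D)) {y : EuclideanSpace ℝ (Fin d)} (hy : y ∈ Y) :
    0 ≤ jointDensity X M f p lam x y :=
  mul_nonneg (hp y hy) (h.uniformAlong.gaussDensity_pos h.measurableSet_codomain hlam hy x).le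

theorem integrableOn_jointDensity (h : IsRegularAt X M Y f y₀) (hp_nonneg : ∀ y ∈ Y, 0 ≤ p y)
    (hp_int : IntegrableOn p Y) {lam : ℝ} (hlam : 0 < lam) (x : EuclideanSpace ℝ (Fin D)) :
    IntegrableOn (jointDensity X M f p lam x) Y := by
  obtain ⟨c, hc, h_density⟩ := h.uniformAlong.exists_gaussDensity_le h.measurableSet_codomain
  obtain ⟨K, hK_nonneg, hK⟩ := h_density 1 one_pos
  refine (hp_int.mul_const (K * Real.exp (lam * 1))).mono'
    (h.aestronglyMeasurable_jointDensity hp_int.aestronglyMeasurable lam x)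
    (ae_restrict_of_forall_mem h.measurableSet_domain fun y hy => ?_)
  rw [Real.norm_of_nonneg (h.jointDensity_nonneg hp_nonneg hlam x hy)]
  refine mul_le_mul_of_nonneg_left ((hK lam hlam y hy x).trans ?_) (hp_nonneg y hy)
  gcongr
  exact sub_le_self 1 (by positivity)

theorem evidence_pos (h : IsRegularAt X M Y f y₀) (hp_nonneg : ∀ y ∈ Y, 0 ≤ p y)
    (hp_int : IntegrableOn p Y) (hp_cont : ContinuousAt p y₀) (hp_pos : 0 < p y₀) {lam : ℝ}
    (hlam : 0 < lam) (x : EuclideanSpace ℝ (Fin D)) : 0 < evidence X M Y f p lam x := by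
  rw [evidence, setIntegral_pos_iff_support_of_nonneg_ae
    (ae_restrict_of_forall_mem h.measurableSet_domain
      fun y hy => h.jointDensity_nonneg hp_nonneg hlam x hy)
    (h.integrableOn_jointDensity hp_nonneg hp_int hlam x)]
  refine Measure.measure_pos_of_mem_nhds volume (x := y₀) ?_
  filter_upwards [h.domain_mem_nhds, hp_cont.eventually (lt_mem_nhds hp_pos)] with y hy hpy
  exact ⟨(mul_pos hpy
    (h.uniformAlong.gaussDensity_pos h.measurableSet_codomain hlam hy x)).ne', hy⟩

section Evidence

theorem exists_eventually_jointDensity_le (h : IsRegularAt X M Y f y₀)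
    (hp_nonneg : ∀ y ∈ Y, 0 ≤ p y) (hp_cont : ContinuousAt p y₀) :
    ∃ K, ∃ b > 0, ∀ᶠ z : ℝ × EuclideanSpace ℝ (Fin d) in atTop ×ˢ 𝓝 y₀,
      (√z.1 ^ D)⁻¹ * jointDensity X M f p z.1 (f y₀) z.2 ≤
        K * Real.exp (-b * ‖√z.1 • (z.2 - y₀)‖ ^ 2) := by
  obtain ⟨c, hc, h_low⟩ := h.uniformAlong.lower
  obtain ⟨k, hk, h_expand⟩ := exists_eventually_mul_norm_sub_le h.differentiableAt h.rank_jacobian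
  set W := gaussMass (M (f y₀))
  have hW : 0 < W := h.gaussMass_metric_pos
  have hp₀ := hp_nonneg y₀ h.mem_domain
  refine ⟨(p y₀ + 1) / (W / 2), c / 2 * k ^ 2, by positivity, ?_⟩
  have hZ := (h.tendsto_sqrt_pow_mul_gaussZ tendsto_fst tendsto_snd).eventually
    (lt_mem_nhds (half_lt_self hW))
  filter_upwards [hZ, tendsto_fst.eventually (eventually_gt_atTop (0 : ℝ)),
    tendsto_snd.eventually ((hp_cont.eventually (gt_mem_nhds (lt_add_one (p y₀)))).and
      (h_expand.and h.domain_mem_nhds))] with z hZz hz ⟨hpz, h_expand_z, hzY⟩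
  have := hp_nonneg z.2 hzY
  have h_norm : k * ‖√z.1 • (z.2 - y₀)‖ ≤ ‖√z.1 • (f y₀ - f z.2)‖ := by
    rw [norm_smul, norm_smul, mul_left_comm, norm_sub_rev (f y₀)]
    gcongr
  have h_kernel : gaussKernel M z.1 (f z.2) (f y₀) ≤
      Real.exp (-(c / 2 * k ^ 2) * ‖√z.1 • (z.2 - y₀)‖ ^ 2) := by
    refine (gaussKernel_le_exp (h_low z.2 hzY) hz.le (f y₀)).trans (Real.exp_le_exp.2 ?_)
    calc -(c / 2) * ‖√z.1 • (f y₀ - f z.2)‖ ^ 2 ≤ -(c / 2) * (k * ‖√z.1 • (z.2 - y₀)‖) ^ 2 :=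
          mul_le_mul_of_nonpos_left (by gcongr) (by linarith)
      _ = -(c / 2 * k ^ 2) * ‖√z.1 • (z.2 - y₀)‖ ^ 2 := by ring
  calc (√z.1 ^ D)⁻¹ * jointDensity X M f p z.1 (f y₀) z.2
      = p z.2 / (√z.1 ^ D * gaussZ X M z.1 (f z.2)) * gaussKernel M z.1 (f z.2) (f y₀) := by
        simp only [jointDensity, gaussDensity, div_eq_mul_inv, mul_inv]
        ring
    _ ≤ (p y₀ + 1) / (W / 2) * Real.exp (-(c / 2 * k ^ 2) * ‖√z.1 • (z.2 - y₀)‖ ^ 2) := by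
        gcongr
        exact (gaussKernel_pos _ _ _ _).le

theorem exists_tendsto_setIntegral_jointDensity_ball (h : IsRegularAt X M Y f y₀)
    (hp_nonneg : ∀ y ∈ Y, 0 ≤ p y) (hp_meas : AEStronglyMeasurable p (volume.restrict Y))
    (hp_cont : ContinuousAt p y₀) :
    ∃ δ > 0, Metric.ball y₀ δ ⊆ Y ∧ Tendsto (fun lam => √lam ^ d *
      ∫ y in Metric.ball y₀ δ, (√lam ^ D)⁻¹ * jointDensity X M f p lam (f y₀) y) atTop
      (𝓝 (p y₀ / gaussMass (M (f y₀)) * gaussMass (pullbackMetric f M y₀))) := by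
  obtain ⟨K, b, hb, h_le⟩ := h.exists_eventually_jointDensity_le hp_nonneg hp_cont
  obtain ⟨P, hP, Q, hQ, h_le⟩ := eventually_prod_iff.1 h_le
  obtain ⟨δ, hδ, h_ball⟩ := Metric.mem_nhds_iff.1 (inter_mem hQ h.domain_mem_nhds)
  have h_ball_Y : Metric.ball y₀ δ ⊆ Y := fun y hy => (h_ball hy).2
  refine ⟨δ, hδ, h_ball_Y, ?_⟩
  have key := tendsto_pow_finrank_smul_setIntegral (μ := volume) (s := fun lam => √lam)
    (F := fun lam y => (√lam ^ D)⁻¹ * jointDensity X M f p lam (f y₀) y)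
    (β := fun u => p y₀ / gaussMass (M (f y₀)) *
      Real.exp (-(1 / 2) * metricSq (pullbackMetric f M y₀) u))
    (bound := fun u => K * Real.exp (-b * ‖u‖ ^ 2)) measurableSet_ball
    (Metric.ball_mem_nhds y₀ hδ) Real.tendsto_sqrt_atTop tendsto_const_nhds ?_ ?_
    ((integrable_exp_neg_mul_norm_sq hb).const_mul K) ?_
  · simpa only [finrank_euclideanSpace_fin, smul_eq_mul, integral_const_mul, gaussMass] using key
  · exact Eventually.of_forall fun lam => ((h.aestronglyMeasurable_jointDensity hp_meas lam
      (f y₀)).mono_set h_ball_Y).const_mul _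
  · filter_upwards [hP, eventually_gt_atTop 0] with lam hlam hlam_pos y hy
    have h_nonneg := h.jointDensity_nonneg hp_nonneg hlam_pos (f y₀) (h_ball_Y hy)
    rw [Real.norm_of_nonneg (by positivity)]
    exact h_le hlam (h_ball hy).1
  · refine Eventually.of_forall fun u => ?_
    have h_ratio := (h.tendsto_jointDensity_div_gaussKernel (y := fun lam => y₀ + (√lam)⁻¹ • u)
      hp_cont tendsto_id (isBigO_add_inv_sqrt_smul_sub y₀ u atTop)).mul_const
        (Real.exp (-(1 / 2) * metricSq (pullbackMetric f M y₀) u))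
    refine h_ratio.congr' ?_
    filter_upwards [eventually_gt_atTop 0] with lam hlam
    rw [id, ← gaussKernel_add_inv_smul _ y₀ u hlam, div_mul_cancel₀ _ (gaussKernel_pos _ _ _ _).ne']

theorem exists_jointDensity_le_exp_of_le_norm_sub (h : IsRegularAt X M Y f y₀)
    (hp_nonneg : ∀ y ∈ Y, 0 ≤ p y) {δ : ℝ} (hδ : 0 < δ) :
    ∃ σ > 0, ∃ K, ∀ lam > 0, ∀ y ∈ Y, δ ≤ ‖y - y₀‖ →
      jointDensity X M f p lam (f y₀) y ≤ p y * (K * Real.exp (-σ * lam)) := by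
  obtain ⟨c, hc, h_density⟩ := h.uniformAlong.exists_gaussDensity_le h.measurableSet_codomain
  obtain ⟨η, hη, h_sep⟩ := h.separated δ hδ
  obtain ⟨K, hK_nonneg, hK⟩ := h_density (c * η ^ 2 / 2) (by positivity)
  refine ⟨c * η ^ 2 / 2, by positivity, K, fun lam hlam y hy hyδ => ?_⟩
  refine mul_le_mul_of_nonneg_left ((hK lam hlam y hy (f y₀)).trans ?_) (hp_nonneg y hy)
  have h_far : η ≤ ‖f y₀ - f y‖ := h_sep y hy hyδ
  refine mul_le_mul_of_nonneg_left (Real.exp_le_exp.2 ?_) hK_nonneg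
  calc lam * (c * η ^ 2 / 2 - c * ‖f y₀ - f y‖ ^ 2) ≤ lam * (c * η ^ 2 / 2 - c * η ^ 2) := by
        gcongr
    _ = -(c * η ^ 2 / 2) * lam := by ring

theorem tendsto_setIntegral_jointDensity_sdiff_ball (h : IsRegularAt X M Y f y₀)
    (hp_nonneg : ∀ y ∈ Y, 0 ≤ p y) (hp_int : IntegrableOn p Y) {δ : ℝ} (hδ : 0 < δ) :
    Tendsto (fun lam => √lam ^ d *
      ∫ y in Y \ Metric.ball y₀ δ, (√lam ^ D)⁻¹ * jointDensity X M f p lam (f y₀) y)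
      atTop (𝓝 0) := by
  obtain ⟨σ, hσ, K, h_joint⟩ := h.exists_jointDensity_le_exp_of_le_norm_sub hp_nonneg hδ
  have h_meas : MeasurableSet (Y \ Metric.ball y₀ δ) :=
    h.measurableSet_domain.diff measurableSet_ball
  have h_upper := (tendsto_rpow_mul_exp_neg_mul_atTop_nhds_zero ((d : ℝ) / 2 - D / 2) σ
    hσ).const_mul ((∫ y in Y \ Metric.ball y₀ δ, p y) * K)
  rw [mul_zero] at h_upper
  refine squeeze_zero' ?_ ?_ h_upper
  · filter_upwards [eventually_gt_atTop 0] with lam hlam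
    refine mul_nonneg (by positivity) (setIntegral_nonneg h_meas fun y hy => ?_)
    exact mul_nonneg (by positivity) (h.jointDensity_nonneg hp_nonneg hlam _ hy.1)
  · filter_upwards [eventually_gt_atTop 0] with lam hlam
    have h_rpow : √lam ^ d * (√lam ^ D)⁻¹ = lam ^ ((d : ℝ) / 2 - D / 2) := by
      rw [Real.rpow_sub hlam, Real.rpow_div_two_eq_sqrt _ hlam.le,
        Real.rpow_div_two_eq_sqrt _ hlam.le, Real.rpow_natCast, Real.rpow_natCast, div_eq_mul_inv]
    calc _ = √lam ^ d * (√lam ^ D)⁻¹ *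
          ∫ y in Y \ Metric.ball y₀ δ, jointDensity X M f p lam (f y₀) y := by
          rw [integral_const_mul, mul_assoc]
      _ ≤ √lam ^ d * (√lam ^ D)⁻¹ *
          ∫ y in Y \ Metric.ball y₀ δ, p y * (K * Real.exp (-σ * lam)) := by
          refine mul_le_mul_of_nonneg_left (setIntegral_mono_on ?_
            ((hp_int.mono_set Set.sdiff_subset).mul_const _) h_meas fun y hy =>
              h_joint lam hlam y hy.1 (not_lt.1 fun hlt => hy.2 (mem_ball_iff_norm.2 hlt)))
            (by positivity)
          exact (h.integrableOn_jointDensity hp_nonneg hp_int hlam (f y₀)).mono_set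
            Set.sdiff_subset
      _ = _ := by rw [integral_mul_const, h_rpow]; ring

theorem tendsto_evidence (h : IsRegularAt X M Y f y₀) (hp_nonneg : ∀ y ∈ Y, 0 ≤ p y)
    (hp_int : IntegrableOn p Y) (hp_cont : ContinuousAt p y₀) :
    Tendsto (fun lam => √lam ^ d * ((√lam ^ D)⁻¹ * evidence X M Y f p lam (f y₀))) atTop
      (𝓝 (p y₀ / gaussMass (M (f y₀)) * gaussMass (pullbackMetric f M y₀))) := by
  obtain ⟨δ, hδ, h_ball, h_near⟩ := h.exists_tendsto_setIntegral_jointDensity_ball hp_nonneg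
    hp_int.aestronglyMeasurable hp_cont
  have h_far := h.tendsto_setIntegral_jointDensity_sdiff_ball hp_nonneg hp_int hδ
  have h_sum := h_near.add h_far
  rw [add_zero] at h_sum
  refine h_sum.congr' ?_
  filter_upwards [eventually_gt_atTop 0] with lam hlam
  have h_int : IntegrableOn (jointDensity X M f p lam (f y₀)) Y :=
    h.integrableOn_jointDensity hp_nonneg hp_int hlam (f y₀)
  have h_split := integral_inter_add_sdiff measurableSet_ball (t := Metric.ball y₀ δ) h_int
  rw [Set.inter_eq_right.2 h_ball] at h_split
  rw [integral_const_mul, integral_const_mul, evidence, ← h_split]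
  ring

end Evidence

section Posterior

theorem tendsto_posteriorDensity_div_gaussDensity {ι : Type*} {l : Filter ι}
    [l.IsCountablyGenerated] {lam : ι → ℝ} {y : ι → EuclideanSpace ℝ (Fin d)}
    (h : IsRegularAt X M Y f y₀) (hp_nonneg : ∀ y ∈ Y, 0 ≤ p y) (hp_int : IntegrableOn p Y)
    (hp_cont : ContinuousAt p y₀) (hp_pos : 0 < p y₀) (hlam : Tendsto lam l atTop)
    (hy : (fun i => y i - y₀) =O[l] fun i => (√(lam i))⁻¹) :
    Tendsto (fun i => posteriorDensity X M Y f p (lam i) (f y₀) (y i) /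
      gaussDensity Y (pullbackMetric f M) (lam i) y₀ (y i)) l (𝓝 1) := by
  have hm := h.gaussMass_pullbackMetric_pos
  have hW := h.gaussMass_metric_pos
  have h_lim := ((h.tendsto_jointDensity_div_gaussKernel hp_cont hlam hy).mul
    (h.tendsto_sqrt_pow_mul_gaussZ_pullbackMetric hlam)).div
    ((h.tendsto_evidence hp_nonneg hp_int hp_cont).comp hlam) (by positivity)
  rw [div_self (by positivity)] at h_lim
  refine h_lim.congr' ?_
  filter_upwards [hlam.eventually_gt_atTop 0] with i hi
  have := Real.sqrt_pos.2 hi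
  simp only [Pi.div_apply, Function.comp_apply, posteriorDensity, gaussDensity]
  field_simp

theorem eventually_abs_posteriorDensity_div_gaussDensity_sub_one_lt (h : IsRegularAt X M Y f y₀)
    (hp_nonneg : ∀ y ∈ Y, 0 ≤ p y) (hp_int : IntegrableOn p Y) (hp_cont : ContinuousAt p y₀)
    (hp_pos : 0 < p y₀) (R : ℝ) {ε : ℝ} (hε : 0 < ε) :
    ∀ᶠ lam in atTop, ∀ y, ‖y - y₀‖ ≤ R / √lam →
      |posteriorDensity X M Y f p lam (f y₀) y /
        gaussDensity Y (pullbackMetric f M) lam y₀ y - 1| < ε := by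
  have hO : (fun z : ℝ × EuclideanSpace ℝ (Fin d) => z.2 - y₀)
      =O[(atTop ×ˢ ⊤) ⊓ 𝓟 {z | ‖z.2 - y₀‖ ≤ R / √z.1}] fun z => (√z.1)⁻¹ := by
    refine Asymptotics.IsBigO.of_bound R (eventually_inf_principal.2 (Eventually.of_forall ?_))
    intro z hz
    rwa [Real.norm_of_nonneg (by positivity), ← div_eq_mul_inv]
  have h_lim := h.tendsto_posteriorDensity_div_gaussDensity hp_nonneg hp_int hp_cont hp_pos
    (tendsto_fst.mono_left inf_le_left) hO
  have h_ev := eventually_inf_principal.1 (h_lim.eventually (Metric.ball_mem_nhds 1 hε))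
  rw [← principal_univ, eventually_prod_principal_iff] at h_ev
  exact h_ev.mono fun lam hlam y => hlam y (Set.mem_univ y)

theorem integrableOn_posteriorDensity (h : IsRegularAt X M Y f y₀) (hp_nonneg : ∀ y ∈ Y, 0 ≤ p y)
    (hp_int : IntegrableOn p Y) {lam : ℝ} (hlam : 0 < lam) (x : EuclideanSpace ℝ (Fin D)) :
    IntegrableOn (posteriorDensity X M Y f p lam x) Y :=
  (h.integrableOn_jointDensity hp_nonneg hp_int hlam x).div_const _

theorem integrable_gaussDensity_pullbackMetric (h : IsRegularAt X M Y f y₀) {lam : ℝ}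
    (hlam : 0 < lam) : Integrable (gaussDensity Y (pullbackMetric f M) lam y₀) := by
  obtain ⟨κ, hκ, h_pull⟩ := h.exists_mul_norm_sq_le_pullbackMetric
  exact (integrable_gaussKernel hκ h_pull hlam).div_const _

theorem gaussZ_pullbackMetric_pos (h : IsRegularAt X M Y f y₀) {lam : ℝ} (hlam : 0 < lam) :
    0 < gaussZ Y (pullbackMetric f M) lam y₀ := by
  obtain ⟨κ, hκ, h_pull⟩ := h.exists_mul_norm_sq_le_pullbackMetric
  have : NeZero (volume.restrict Y) :=
    ⟨Measure.restrict_eq_zero.not.2 (Measure.measure_pos_of_mem_nhds _ h.domain_mem_nhds).ne'⟩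
  exact integral_exp_pos (integrable_gaussKernel hκ h_pull hlam).integrableOn

theorem gaussDensity_pullbackMetric_pos (h : IsRegularAt X M Y f y₀) {lam : ℝ} (hlam : 0 < lam)
    (y : EuclideanSpace ℝ (Fin d)) : 0 < gaussDensity Y (pullbackMetric f M) lam y₀ y :=
  div_pos (gaussKernel_pos _ _ _ _) (h.gaussZ_pullbackMetric_pos hlam)

theorem exists_eventually_gaussDensity_pullbackMetric_le (h : IsRegularAt X M Y f y₀) :
    ∃ K, ∃ b > 0, ∀ᶠ lam in atTop, ∀ y,
      (√lam ^ d)⁻¹ * gaussDensity Y (pullbackMetric f M) lam y₀ y ≤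
        K * Real.exp (-b * ‖√lam • (y - y₀)‖ ^ 2) := by
  obtain ⟨κ, hκ, h_pull⟩ := h.exists_mul_norm_sq_le_pullbackMetric
  set m := gaussMass (pullbackMetric f M y₀)
  have hm : 0 < m := h.gaussMass_pullbackMetric_pos
  refine ⟨(m / 2)⁻¹, κ / 2, half_pos hκ, ?_⟩
  filter_upwards [eventually_gt_atTop 0, (h.tendsto_sqrt_pow_mul_gaussZ_pullbackMetric
    tendsto_id).eventually (lt_mem_nhds (half_lt_self hm))] with lam hlam hZ y
  calc (√lam ^ d)⁻¹ * gaussDensity Y (pullbackMetric f M) lam y₀ y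
      = (√lam ^ d * gaussZ Y (pullbackMetric f M) lam y₀)⁻¹ *
          gaussKernel (pullbackMetric f M) lam y₀ y := by rw [gaussDensity, mul_inv]; ring
    _ ≤ (m / 2)⁻¹ * Real.exp (-(κ / 2) * ‖√lam • (y - y₀)‖ ^ 2) := by
      have h_kernel := (gaussKernel_pos (pullbackMetric f M) lam y₀ y).le
      gcongr
      · exact hZ.le
      · exact gaussKernel_le_exp h_pull hlam.le y

theorem tendsto_gaussDensity_pullbackMetric_add_inv_smul (h : IsRegularAt X M Y f y₀)
    (u : EuclideanSpace ℝ (Fin d)) :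
    Tendsto (fun lam => (√lam ^ d)⁻¹ *
      gaussDensity Y (pullbackMetric f M) lam y₀ (y₀ + (√lam)⁻¹ • u)) atTop
      (𝓝 (Real.exp (-(1 / 2) * metricSq (pullbackMetric f M y₀) u) /
        gaussMass (pullbackMetric f M y₀))) := by
  refine (tendsto_const_nhds.div (h.tendsto_sqrt_pow_mul_gaussZ_pullbackMetric tendsto_id)
    h.gaussMass_pullbackMetric_pos.ne').congr' ?_
  filter_upwards [eventually_gt_atTop 0] with lam hlam
  rw [Pi.div_apply, gaussDensity, gaussKernel_add_inv_smul _ y₀ u hlam, id,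
    div_mul_eq_div_div_swap, div_eq_inv_mul]

theorem posteriorDensity_nonneg (h : IsRegularAt X M Y f y₀) (hp : ∀ y ∈ Y, 0 ≤ p y) {lam : ℝ}
    (hlam : 0 < lam) (x : EuclideanSpace ℝ (Fin D)) {y : EuclideanSpace ℝ (Fin d)} (hy : y ∈ Y) :
    0 ≤ posteriorDensity X M Y f p lam x y :=
  div_nonneg (h.jointDensity_nonneg hp hlam x hy) (setIntegral_nonneg h.measurableSet_domain
    fun _ hz => h.jointDensity_nonneg hp hlam x hz)

theorem tendsto_integral_max_gaussDensity_sub_posteriorDensity (h : IsRegularAt X M Y f y₀)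
    (hp_nonneg : ∀ y ∈ Y, 0 ≤ p y) (hp_int : IntegrableOn p Y) (hp_cont : ContinuousAt p y₀)
    (hp_pos : 0 < p y₀) :
    Tendsto (fun lam => ∫ y in Y, max (gaussDensity Y (pullbackMetric f M) lam y₀ y -
      posteriorDensity X M Y f p lam (f y₀) y) 0) atTop (𝓝 0) := by
  obtain ⟨K, b, hb, h_le⟩ := h.exists_eventually_gaussDensity_pullbackMetric_le
  have key := tendsto_pow_finrank_smul_setIntegral (μ := volume) (s := fun lam => √lam)
    (F := fun lam y => (√lam ^ d)⁻¹ * max (gaussDensity Y (pullbackMetric f M) lam y₀ y -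
      posteriorDensity X M Y f p lam (f y₀) y) 0) (β := fun _ => 0)
    (bound := fun u => K * Real.exp (-b * ‖u‖ ^ 2)) h.measurableSet_domain h.domain_mem_nhds
    Real.tendsto_sqrt_atTop tendsto_const_nhds ?_ ?_
    ((integrable_exp_neg_mul_norm_sq hb).const_mul K) ?_
  · rw [integral_zero] at key
    refine key.congr' ?_
    filter_upwards [eventually_gt_atTop 0] with lam hlam
    have := Real.sqrt_pos.2 hlam
    rw [finrank_euclideanSpace_fin, smul_eq_mul, integral_const_mul,
      mul_inv_cancel_left₀ (by positivity)]
  · filter_upwards [eventually_gt_atTop 0] with lam hlam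
    exact (((h.integrable_gaussDensity_pullbackMetric hlam).integrableOn.sub
      (h.integrableOn_posteriorDensity hp_nonneg hp_int hlam (f y₀))).pos_part.const_mul
      _).aestronglyMeasurable
  · filter_upwards [eventually_gt_atTop 0, h_le] with lam hlam h_le_lam y hy
    rw [Real.norm_of_nonneg (by positivity)]
    refine (mul_le_mul_of_nonneg_left ?_ (by positivity)).trans (h_le_lam y)
    exact max_le (sub_le_self _ (h.posteriorDensity_nonneg hp_nonneg hlam _ hy))
      (h.gaussDensity_pullbackMetric_pos hlam y).le
  · refine Eventually.of_forall fun u => ?_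
    have h_ratio := h.tendsto_posteriorDensity_div_gaussDensity hp_nonneg hp_int hp_cont hp_pos
      tendsto_id (isBigO_add_inv_sqrt_smul_sub y₀ u atTop)
    have h_lim := (h.tendsto_gaussDensity_pullbackMetric_add_inv_smul u).mul
      ((h_ratio.const_sub 1).max (tendsto_const_nhds (x := (0 : ℝ))))
    rw [sub_self, max_self, mul_zero] at h_lim
    refine h_lim.congr' ?_
    filter_upwards [eventually_gt_atTop 0] with lam hlam
    have hg := h.gaussDensity_pullbackMetric_pos hlam (y₀ + (√lam)⁻¹ • u)
    rw [mul_assoc, mul_max_of_nonneg _ _ hg.le, mul_one_sub, mul_zero, id,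
      mul_div_cancel₀ _ hg.ne']

theorem tendsto_integral_abs_posteriorDensity_sub_gaussDensity (h : IsRegularAt X M Y f y₀)
    (hp_nonneg : ∀ y ∈ Y, 0 ≤ p y) (hp_int : IntegrableOn p Y) (hp_cont : ContinuousAt p y₀)
    (hp_pos : 0 < p y₀) :
    Tendsto (fun lam => ∫ y in Y, |posteriorDensity X M Y f p lam (f y₀) y -
      gaussDensity Y (pullbackMetric f M) lam y₀ y|) atTop (𝓝 0) := by
  have h_lim := (h.tendsto_integral_max_gaussDensity_sub_posteriorDensity hp_nonneg hp_int hp_cont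
    hp_pos).const_mul 2
  rw [mul_zero] at h_lim
  refine h_lim.congr' ?_
  filter_upwards [eventually_gt_atTop 0] with lam hlam
  refine (integral_abs_sub_eq_two_mul_integral_max
    (h.integrableOn_posteriorDensity hp_nonneg hp_int hlam _)
    (h.integrable_gaussDensity_pullbackMetric hlam).integrableOn ?_).symm
  calc ∫ y in Y, posteriorDensity X M Y f p lam (f y₀) y = 1 := by
        simp only [posteriorDensity]
        rw [integral_div]
        exact div_self (h.evidence_pos hp_nonneg hp_int hp_cont hp_pos hlam _).ne'
    _ = ∫ y in Y, gaussDensity Y (pullbackMetric f M) lam y₀ y := by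
        simp only [gaussDensity]
        rw [integral_div]
        exact (div_self (h.gaussZ_pullbackMetric_pos hlam).ne').symm

end Posterior

end IsRegularAt

end RiemGauss

theorem theorem8_general {d D : ℕ} {X : Set (EuclideanSpace ℝ (Fin D))}
    {M : EuclideanSpace ℝ (Fin D) → Matrix (Fin D) (Fin D) ℝ} {Y : Set (EuclideanSpace ℝ (Fin d))}
    {f : EuclideanSpace ℝ (Fin d) → EuclideanSpace ℝ (Fin D)} {p : EuclideanSpace ℝ (Fin d) → ℝ}
    {y₀ : EuclideanSpace ℝ (Fin d)} (h : RiemGauss.IsRegularAt X M Y f y₀)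
    (hp_nonneg : ∀ y ∈ Y, 0 ≤ p y) (hp_int : IntegrableOn p Y) (hp_cont : ContinuousAt p y₀)
    (hp_pos : 0 < p y₀) :
    (∀ lam : ℝ, 0 < lam →
      IntegrableOn (RiemGauss.jointDensity X M f p lam (f y₀)) Y ∧
      0 < RiemGauss.evidence X M Y f p lam (f y₀)) ∧
    Tendsto (fun lam : ℝ => ∫⁻ y in Y, ENNReal.ofReal
        |RiemGauss.posteriorDensity X M Y f p lam (f y₀) y -
          RiemGauss.gaussDensity Y (RiemGauss.pullbackMetric f M) lam y₀ y|)
      atTop (𝓝 0) ∧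
    (∀ R : ℝ, ∀ ε : ℝ, 0 < ε → ∀ᶠ lam : ℝ in atTop,
      ∀ y ∈ Y, ‖y - y₀‖ ≤ R / √lam →
        |RiemGauss.posteriorDensity X M Y f p lam (f y₀) y /
          RiemGauss.gaussDensity Y (RiemGauss.pullbackMetric f M) lam y₀ y - 1| < ε) := by
  refine ⟨fun lam hlam => ⟨h.integrableOn_jointDensity hp_nonneg hp_int hlam _,
    h.evidence_pos hp_nonneg hp_int hp_cont hp_pos hlam _⟩, ?_, fun R ε hε =>
    (h.eventually_abs_posteriorDensity_div_gaussDensity_sub_one_lt hp_nonneg hp_int hp_cont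
      hp_pos R hε).mono fun lam hlam y _ => hlam y⟩
  have h_tv := ENNReal.tendsto_ofReal
    (h.tendsto_integral_abs_posteriorDensity_sub_gaussDensity hp_nonneg hp_int hp_cont hp_pos)
  rw [ENNReal.ofReal_zero] at h_tv
  refine h_tv.congr' ?_
  filter_upwards [eventually_gt_atTop 0] with lam hlam
  exact ofReal_integral_eq_lintegral_ofReal
    ((h.integrableOn_posteriorDensity hp_nonneg hp_int hlam _).sub
      (h.integrable_gaussDensity_pullbackMetric hlam).integrableOn).abs
    (Eventually.of_forall fun _ => abs_nonneg _)

theorem theorem8 {d D : ℕ}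
    (X : Set (EuclideanSpace ℝ (Fin D))) (hX : IsOpen X)
    (M : EuclideanSpace ℝ (Fin D) → Matrix (Fin D) (Fin D) ℝ)
    (hM : RiemGauss.IsMetricOn M X)
    (Y : Set (EuclideanSpace ℝ (Fin d))) (hY : IsOpen Y)
    (f : EuclideanSpace ℝ (Fin d) → EuclideanSpace ℝ (Fin D))
    (hf : RiemGauss.IsSmoothEmbeddingOn f Y X)
    (hunif : RiemGauss.UniformAlong X M Y f)
    (p : EuclideanSpace ℝ (Fin d) → ℝ)
    (hp_smooth : ContDiffOn ℝ ∞ p Y) (hp_nonneg : ∀ y ∈ Y, 0 ≤ p y)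
    (hp_one : ∫ y in Y, p y = 1)
    (x : EuclideanSpace ℝ (Fin D)) (y₀ : EuclideanSpace ℝ (Fin d))
    (hy₀ : y₀ ∈ Y) (hx : f y₀ = x) (hp_pos : 0 < p y₀) :
    -- the posterior is well defined
    (∀ lam : ℝ, 0 < lam →
      IntegrableOn (RiemGauss.jointDensity X M f p lam x) Y ∧
      0 < RiemGauss.evidence X M Y f p lam x) ∧
    -- convergence of the densities in `L¹(Y)`, i.e. in total variation
    Tendsto (fun lam : ℝ => ∫⁻ y in Y, ENNReal.ofReal
        |RiemGauss.posteriorDensity X M Y f p lam x y -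
          RiemGauss.gaussDensity Y (RiemGauss.pullbackMetric f M) lam y₀ y|)
      atTop (𝓝 0) ∧
    -- the ratio of the densities tends to one, uniformly at the scale `lam ^ (-1/2)`
    (∀ R : ℝ, ∀ ε : ℝ, 0 < ε → ∀ᶠ lam : ℝ in atTop,
      ∀ y ∈ Y, ‖y - y₀‖ ≤ R / Real.sqrt lam →
        |RiemGauss.posteriorDensity X M Y f p lam x y /
          RiemGauss.gaussDensity Y (RiemGauss.pullbackMetric f M) lam y₀ y - 1| < ε) := by
  subst hx
  exact theorem8_general (hf.isRegularAt hM hunif hX hY hy₀) hp_nonneg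
    (Integrable.of_integral_ne_zero (hp_one ▸ one_ne_zero))
    (hp_smooth.continuousOn.continuousAt (hY.mem_nhds hy₀)) hp_pos
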